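/- Let $k$ be an algebraically closed field. A variety over $k$ is a reduced, separated scheme of finite type over $k$ (not necessarily irreducible); its points are its closed, equivalently $k$-rational, points. An algebraic monoid is a variety $M$ over $k$ together with a morphism of varieties $\mu : M \times M \to M$, $(x,y) \mapsto xy$, and a point $1 \in M$ such that $\mu$ is associative and $1$ is a neutral element. An algebraic group is an algebraic monoid which is a group and whose inverse map is a morphism of varieties. The unit group of $M$ is $$G(M) = \{x \in M : xy = yx = 1 \text{ for some } y \in M\}.$$ Theorem. For every algebraic monoid $M$ over $k$, the unit group $G(M)$ is open in $M$, and it is an algebraic group for the structure of open subvariety of $M$ and the restriction of the multiplication of $M$. In particular, every point $x$ of $G(M)$ is a nonsingular point of $M$, that is, the local ring $\mathcal{O}_{M,x}$ is regular. -/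

import Mathlib

open CategoryTheory AlgebraicGeometry
open scoped MonoidalCategory MonObj

universe u

namespace AlgMon

/-- A variety over `k`: a reduced, separated `k`-scheme of finite type
(not necessarily irreducible, nor connected). -/
class IsVariety {k : Type u} [Field k] (X : Over (Spec (.of k))) : Prop where
  reduced : IsReduced X.left
  separated : IsSeparated X.hom
  locallyOfFiniteType : LocallyOfFiniteType X.hom
  quasiCompact : QuasiCompact X.hom

/-- The closed point of the underlying scheme of `X` that corresponds to a `k`-rational point
`x : Spec k ⟶ X` (a morphism over `Spec k`; the tensor unit `𝟙_` of `Over (Spec k)` is `Spec k`). -/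
noncomputable def toPoint {k : Type u} [Field k] {X : Over (Spec (.of k))}
    (x : 𝟙_ (Over (Spec (.of k))) ⟶ X) : X.left :=
  x.left (IsLocalRing.closedPoint k : Spec (.of k))

/-- The unit group `G(M)`, as a set of points of `M`. The points `Spec k ⟶ M` carry the monoid law
`x * y = (x, y) ≫ μ` with neutral element `η`, and `G(M)` is the set of its invertible elements. -/
def unitGroup {k : Type u} [Field k] (M : Over (Spec (.of k))) [MonObj M] : Set M.left :=
  {p | ∃ x : 𝟙_ (Over (Spec (.of k))) ⟶ M, IsUnit x ∧ toPoint x = p}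

/-- An open subset `U` of a `k`-scheme `X`, as an open subscheme over `k`. -/
noncomputable def openSub {k : Type u} [Field k] (X : Over (Spec (.of k))) (U : X.left.Opens) :
    Over (Spec (.of k)) :=
  Over.mk (U.ι ≫ X.hom)

/-- The inclusion of an open subscheme, as a morphism over `k`. -/
noncomputable def openSubι {k : Type u} [Field k] (X : Over (Spec (.of k))) (U : X.left.Opens) :
    openSub X U ⟶ X :=
  Over.homMk U.ι rfl

/-- A point of a scheme is nonsingular if its local ring is a regular local ring. -/
def IsNonsingularAt (X : Scheme.{u}) (p : X) : Prop :=
  IsRegularLocalRing (X.presheaf.stalk p)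

end AlgMon

/-! The units of `M` form the scheme `G` of triples `(x, y, z)` with `xy = 1 = zx`, the pullback of
`shear M : (x, y, z) ↦ (x, xy, zx)` along `x ↦ (x, 1, 1)`. Uniqueness of inverses makes `p : G ⟶ M`
a monomorphism (`RepresentsUnits.of_isPullback_shear`), so it is enough to show that `p` is smooth:
a flat monomorphism locally of finite presentation is an open immersion.

The shear fixes `(1, 1, 1)`, and its scheme-theoretic fibre there is this single rational point. The
stalk map is therefore a local map between isomorphic Noetherian local rings under which the maximal
ideal generates the maximal ideal and the residue fields agree. Counting modulo powers of the
maximal ideals forces it to be flat, hence formally smooth (`mem_smoothLocus_of_isPullback`). By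
base change `p` is smooth at the identity, and by translation at every closed point.

For nonsingularity, the smooth locus of the reduced scheme `M` over a perfect field is dense, so it
meets the units; translations carry it to every unit. -/

/-! ### Local algebra: flatness, formal smoothness and regularity. -/

section LocalAlgebra

open IsLocalRing TensorProduct

/-- The kernels of the powers of `g` stabilize, say at `n`. If `g x = 0` and `x = g ^ n y`, then `y`
lies in the kernel of `g ^ (n + 1)`, hence of `g ^ n`, so `x = 0`. -/
theorem RingHom.injective_of_surjective_endomorphism {R : Type*} [CommRing R] [IsNoetherianRing R]
    (g : R →+* R) (hg : Function.Surjective g) : Function.Injective g := by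
  have hmono : Monotone fun n : ℕ ↦ RingHom.ker (g ^ n) := by
    refine monotone_nat_of_le_succ fun n x hx ↦ ?_
    rw [RingHom.mem_ker] at hx ⊢
    rw [pow_succ', RingHom.mul_def, RingHom.comp_apply, hx, map_zero]
  obtain ⟨n, hn⟩ := monotone_stabilizes_iff_noetherian.mpr ‹IsNoetherianRing R› ⟨_, hmono⟩
  have hn : RingHom.ker (g ^ n) = RingHom.ker (g ^ (n + 1)) := hn (n + 1) n.le_succ
  have hsurj : Function.Surjective (g ^ n) := by
    rw [RingHom.coe_pow]
    exact hg.iterate n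
  rw [injective_iff_map_eq_zero]
  intro x hx
  obtain ⟨y, rfl⟩ := hsurj x
  have : y ∈ RingHom.ker (g ^ (n + 1)) := by
    rw [RingHom.mem_ker, pow_succ', RingHom.mul_def, RingHom.comp_apply, hx]
  rwa [← hn] at this

namespace IsLocalRing

variable {A B : Type*} [CommRing A] [CommRing B] [IsLocalRing A] [IsLocalRing B] [Algebra A B]

/-- Successive approximation: each power of the maximal ideal of `B` is generated by elements from
`A`, and coefficients in `B` may be replaced by elements of `A` modulo the maximal ideal. -/
theorem exists_sub_algebraMap_mem_maximalIdeal_pow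
    (hmax : (maximalIdeal A).map (algebraMap A B) = maximalIdeal B)
    (hres : ∀ b : B, ∃ a : A, b - algebraMap A B a ∈ maximalIdeal B) (n : ℕ) (b : B) :
    ∃ a : A, b - algebraMap A B a ∈ maximalIdeal B ^ n := by
  induction n with
  | zero => exact ⟨0, by simp⟩
  | succ n ih =>
    obtain ⟨a, ha⟩ := ih
    suffices ∀ c ∈ maximalIdeal B ^ n, ∃ a : A, c - algebraMap A B a ∈ maximalIdeal B ^ (n + 1) by
      obtain ⟨a', ha'⟩ := this _ ha
      exact ⟨a + a', by rwa [map_add, ← sub_sub]⟩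
    intro c hc
    rw [← hmax, ← Ideal.map_pow] at hc
    induction hc using Submodule.span_induction with
    | mem x hx =>
      obtain ⟨a, -, rfl⟩ := hx
      exact ⟨a, by simp⟩
    | zero => exact ⟨0, by simp⟩
    | add x y _ _ hx hy =>
      obtain ⟨a, ha⟩ := hx
      obtain ⟨a', ha'⟩ := hy
      exact ⟨a + a', by simpa [add_sub_add_comm] using add_mem ha ha'⟩
    | smul b x hx ih =>
      obtain ⟨a, ha⟩ := ih
      obtain ⟨a', ha'⟩ := hres b
      replace hx : x ∈ maximalIdeal B ^ n := by rwa [← hmax, ← Ideal.map_pow]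
      refine ⟨a' * a, ?_⟩
      have h₁ := Ideal.mul_mem_mul hx ha'
      rw [← pow_succ] at h₁
      have : b • x - algebraMap A B (a' * a) =
          x * (b - algebraMap A B a') + algebraMap A B a' * (x - algebraMap A B a) := by
        rw [smul_eq_mul, map_mul]; ring
      rw [this]
      exact add_mem h₁ (Ideal.mul_mem_left _ _ ha)

/-- The isomorphism `e` need not be compatible with the algebra map. It only serves to turn the
surjection of quotients by `n`-th powers into a surjective endomorphism of a Noetherian ring, which
is injective. -/
theorem comap_maximalIdeal_pow_le_of_ringEquiv [IsNoetherianRing A]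
    (e : B ≃+* A)
    (hmax : (maximalIdeal A).map (algebraMap A B) = maximalIdeal B)
    (hres : ∀ b : B, ∃ a : A, b - algebraMap A B a ∈ maximalIdeal B) (n : ℕ) :
    (maximalIdeal B ^ n).comap (algebraMap A B) ≤ maximalIdeal A ^ n := by
  have he : (maximalIdeal B ^ n).map e = maximalIdeal A ^ n := by
    rw [Ideal.map_pow, map_ringEquiv_maximalIdeal]
  let φ : A ⧸ maximalIdeal A ^ n →+* B ⧸ maximalIdeal B ^ n :=
    Ideal.quotientMap _ (algebraMap A B) (by
      rw [← Ideal.map_le_iff_le_comap, Ideal.map_pow, hmax])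
  let ε : B ⧸ maximalIdeal B ^ n ≃+* A ⧸ maximalIdeal A ^ n :=
    Ideal.quotientEquiv _ _ e he.symm
  have hφ : Function.Surjective φ := by
    intro b
    obtain ⟨b, rfl⟩ := Ideal.Quotient.mk_surjective b
    obtain ⟨a, ha⟩ := exists_sub_algebraMap_mem_maximalIdeal_pow hmax hres n b
    exact ⟨Ideal.Quotient.mk _ a, (Ideal.Quotient.eq.mpr ha).symm⟩
  have hinj := RingHom.injective_of_surjective_endomorphism
    ((ε : B ⧸ maximalIdeal B ^ n →+* _).comp φ) (ε.surjective.comp hφ)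
  intro a ha
  rw [← Ideal.Quotient.eq_zero_iff_mem]
  apply hinj
  rw [map_zero, RingHom.comp_apply]
  have : φ (Ideal.Quotient.mk _ a) = 0 := Ideal.Quotient.eq_zero_iff_mem.mpr ha
  rw [this, map_zero]

/-- Artin–Rees places an element of the kernel of `B ⊗ I → B` in every `maximalIdeal B ^ n • ⊤`, and
Krull's intersection theorem then kills it. -/
theorem flat_of_comap_maximalIdeal_pow_le [IsNoetherianRing A] [IsNoetherianRing B]
    (hmax : (maximalIdeal A).map (algebraMap A B) = maximalIdeal B)
    (hres : ∀ b : B, ∃ a : A, b - algebraMap A B a ∈ maximalIdeal B)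
    (hinj : ∀ n, (maximalIdeal B ^ n).comap (algebraMap A B) ≤ maximalIdeal A ^ n) :
    Module.Flat A B := by
  rw [Module.Flat.iff_lTensor_injective']
  intro I
  rw [injective_iff_map_eq_zero]
  intro x hx
  have key : x ∈ (⨅ n : ℕ, maximalIdeal B ^ n • ⊤ : Submodule B (B ⊗[A] I)) := by
    rw [Submodule.mem_iInf]
    intro n
    obtain ⟨k, hk⟩ := Ideal.exists_pow_inf_eq_pow_smul (maximalIdeal A) (I : Submodule A A)
    have hdec (N : ℕ) (x : B ⊗[A] I) : ∃ i : I,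
        x - 1 ⊗ₜ i ∈ (maximalIdeal B ^ N • ⊤ : Submodule B (B ⊗[A] I)) := by
      induction x with
      | zero => exact ⟨0, by simp⟩
      | add x y hx hy =>
        obtain ⟨i, hi⟩ := hx
        obtain ⟨j, hj⟩ := hy
        exact ⟨i + j, by simpa [tmul_add, add_sub_add_comm] using add_mem hi hj⟩
      | tmul b i =>
        obtain ⟨a, ha⟩ := exists_sub_algebraMap_mem_maximalIdeal_pow hmax hres N b
        refine ⟨a • i, ?_⟩
        have : b ⊗ₜ[A] i - 1 ⊗ₜ[A] (a • i) = (b - algebraMap A B a) • (1 ⊗ₜ[A] i) := by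
          rw [smul_tmul', smul_eq_mul, mul_one, sub_tmul, ← smul_tmul, Algebra.smul_def, mul_one]
        rw [this]
        exact Submodule.smul_mem_smul ha trivial
    -- The exponent exceeds `n` by the Artin–Rees constant `k`, which is lost in passing from `i ∈
    -- maximalIdeal A ^ (n + k)` to `i ∈ maximalIdeal A ^ n • I`.
    obtain ⟨i, hi⟩ := hdec (n + k) x
    let ψ : B ⊗[A] I →ₗ[B] B :=
      (AlgebraTensorModule.rid A B B).toLinearMap ∘ₗ AlgebraTensorModule.lTensor B B I.subtype
    have hψx : ψ x = 0 := by
      change AlgebraTensorModule.rid A B B (LinearMap.lTensor B I.subtype x) = 0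
      rw [hx, map_zero]
    have h₁ : ψ (x - 1 ⊗ₜ i) ∈ maximalIdeal B ^ (n + k) := by
      have := Submodule.mem_map_of_mem (f := ψ) hi
      rw [Submodule.map_smul''] at this
      exact (Submodule.smul_mono le_rfl le_top |>.trans
        (by rw [smul_eq_mul, Ideal.mul_top])) this
    have h₂ : (i : A) ∈ maximalIdeal A ^ (n + k) := by
      apply hinj
      rw [map_sub, hψx, zero_sub, neg_mem_iff] at h₁
      simpa [ψ, Algebra.smul_def] using h₁
    have h₃ : (i : A) ∈ maximalIdeal A ^ n • I := by
      have : (i : A) ∈ (maximalIdeal A ^ (n + k) • ⊤ ⊓ I : Submodule A A) :=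
        ⟨by simpa using h₂, i.2⟩
      rw [hk _ (Nat.le_add_left _ _), Nat.add_sub_cancel] at this
      exact Submodule.smul_mono le_rfl inf_le_right this
    have h₄ : (1 : B) ⊗ₜ[A] i ∈ (maximalIdeal B ^ n • ⊤ : Submodule B (B ⊗[A] I)) := by
      have : i ∈ (maximalIdeal A ^ n • ⊤ : Submodule A I) := by
        rwa [Submodule.mem_smul_top_iff]
      refine Submodule.smul_induction_on (p := fun i : I ↦ (1 : B) ⊗ₜ[A] i ∈
        (maximalIdeal B ^ n • ⊤ : Submodule B (B ⊗[A] I))) this (fun a ha j _ ↦ ?_)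
        fun x y hx hy ↦ by rw [tmul_add]; exact add_mem hx hy
      have hsmul : (1 : B) ⊗ₜ[A] (a • j) = algebraMap A B a • ((1 : B) ⊗ₜ[A] j) := by
        rw [tmul_smul, algebraMap_smul]
      rw [hsmul]
      refine Submodule.smul_mem_smul ?_ trivial
      rw [← hmax, ← Ideal.map_pow]
      exact Ideal.mem_map_of_mem _ ha
    have := add_mem (Submodule.smul_mono_left (Ideal.pow_le_pow_right (Nat.le_add_right n k)) hi) h₄
    rwa [sub_add_cancel] at this
  rwa [Ideal.iInf_pow_smul_eq_bot_of_isLocalRing _ (Ideal.IsPrime.ne_top inferInstance),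
    Submodule.mem_bot] at key

end IsLocalRing

-- For a flat algebra essentially of finite type over a Noetherian base, formal smoothness can be
-- tested on the closed fibre; there, unramified over a field implies étale.
attribute [local instance] Algebra.FormallyEtale.of_formallyUnramified_of_field in
theorem Algebra.FormallySmooth.of_flat_of_formallyUnramified {A B : Type*} [CommRing A] [CommRing B]
    [IsLocalRing A] [IsLocalRing B] [IsNoetherianRing A] [Algebra A B]
    [IsLocalHom (algebraMap A B)] [Algebra.EssFiniteType A B] [Module.Flat A B]
    [Algebra.FormallyUnramified A B] : Algebra.FormallySmooth A B := by
  let P := Algebra.EssFiniteType.subalgebra A B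
  have : Algebra.FinitePresentation A P := Algebra.FinitePresentation.of_finiteType.mp inferInstance
  exact Algebra.FormallySmooth.of_formallySmooth_residueField_tensor (P := P)
    (Algebra.EssFiniteType.submonoid A B)

theorem Algebra.FormallySmooth.of_ringEquiv_of_map_maximalIdeal {A B : Type*} [CommRing A]
    [CommRing B] [IsLocalRing A] [IsLocalRing B] [IsNoetherianRing A] [IsNoetherianRing B]
    [Algebra A B] [IsLocalHom (algebraMap A B)] [Algebra.EssFiniteType A B] (e : B ≃+* A)
    (hmax : (maximalIdeal A).map (algebraMap A B) = maximalIdeal B)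
    (hres : ∀ b : B, ∃ a : A, b - algebraMap A B a ∈ maximalIdeal B) :
    Algebra.FormallySmooth A B := by
  have : Module.Flat A B := IsLocalRing.flat_of_comap_maximalIdeal_pow_le hmax hres
    (IsLocalRing.comap_maximalIdeal_pow_le_of_ringEquiv e hmax hres)
  have hsurj : Function.Surjective (algebraMap (ResidueField A) (ResidueField B)) := by
    intro b
    obtain ⟨b, rfl⟩ := residue_surjective b
    obtain ⟨a, ha⟩ := hres b
    exact ⟨residue A a, (Ideal.Quotient.eq.mpr ha).symm⟩
  have : Algebra.IsSeparable (ResidueField A) (ResidueField B) := by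
    constructor
    intro x
    obtain ⟨a, rfl⟩ := hsurj x
    exact isSeparable_algebraMap a
  have : Algebra.FormallyUnramified A B := .of_map_maximalIdeal hmax
  exact .of_flat_of_formallyUnramified

/-- Going down for flat maps gives `dim A ≤ dim B`, while the images of `dim A` generators already
generate the maximal ideal of `B`. -/
theorem IsRegularLocalRing.of_flat_of_map_maximalIdeal {A B : Type*} [CommRing A] [CommRing B]
    [IsRegularLocalRing A] [IsLocalRing B] [IsNoetherianRing B] [Algebra A B]
    [IsLocalHom (algebraMap A B)] [Module.Flat A B]
    (hmax : (maximalIdeal A).map (algebraMap A B) = maximalIdeal B) : IsRegularLocalRing B := by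
  apply IsRegularLocalRing.of_spanFinrank_maximalIdeal_le
  have hfg := (maximalIdeal A).fg_of_isNoetherianRing
  have hfin := Submodule.FG.finite_generators hfg
  have : (maximalIdeal B).LiesOver (maximalIdeal A) :=
    ⟨(((local_hom_TFAE (algebraMap A B)).out 0 4 :
      _ ↔ (maximalIdeal B).comap (algebraMap A B) = maximalIdeal A).mp ‹_›).symm⟩
  have hle : (maximalIdeal A).height ≤ (maximalIdeal B).height := by
    rw [Ideal.height_eq_height_add_of_liesOver_of_hasGoingDown (maximalIdeal A) (maximalIdeal B)]
    exact le_self_add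
  rw [← maximalIdeal_height_eq_ringKrullDim]
  refine le_trans ?_ (WithBot.coe_le_coe.mpr hle)
  rw [maximalIdeal_height_eq_ringKrullDim, ← (isRegularLocalRing_iff A).mp ‹_›, Nat.cast_le,
    ← hmax, ← Submodule.FG.generators_ncard hfg]
  have hspan : (maximalIdeal A).map (algebraMap A B) =
      Ideal.span (algebraMap A B '' (maximalIdeal A).generators) := by
    rw [← Ideal.map_span]
    congr 1
    exact (maximalIdeal A).span_generators.symm
  rw [hspan]
  exact (Submodule.spanFinrank_span_le_ncard_of_finite (hfin.image _)).trans
    (Set.ncard_image_le hfin)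

/-- Near `q` the algebra is étale over a polynomial ring over `R`, which is regular, and regularity
ascends along the étale local map. -/
theorem Algebra.IsSmoothAt.isRegularLocalRing {R S : Type*} [CommRing R] [IsRegularRing R]
    [CommRing S] [Algebra R S]
    [Algebra.FiniteType R S] (q : Ideal S) [q.IsPrime] [Algebra.IsSmoothAt R q] :
    IsRegularLocalRing (Localization.AtPrime q) := by
  have : Algebra.FinitePresentation R S := Algebra.FinitePresentation.of_finiteType.mp inferInstance
  have : IsNoetherianRing S := Algebra.FiniteType.isNoetherianRing R S
  obtain ⟨f, hf, n, _, _, hét⟩ := Algebra.IsSmoothAt.exists_isStandardEtale_mvPolynomial (R := R)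
    (p := q)
  let P := MvPolynomial (Fin n) R
  let T := Localization.Away f
  have hdisj : Disjoint (Submonoid.powers f : Set S) q :=
    (Ideal.disjoint_powers_iff_notMem f (Ideal.IsPrime.isRadical ‹_›)).mpr hf
  let Q : Ideal T := q.map (algebraMap S T)
  have hQ : Q.IsPrime := IsLocalization.isPrime_of_isPrime_disjoint (.powers f) _ _ ‹_› hdisj
  have hQq : Q.under S = q := IsLocalization.under_map_of_isPrime_disjoint (.powers f) _ ‹_› hdisj
  have : IsNoetherianRing T := IsLocalization.isNoetherianRing (.powers f) _ inferInstance
  let p : Ideal P := Q.under P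
  have : Q.LiesOver p := ⟨rfl⟩
  let := Localization.AtPrime.algebraOfLiesOver p Q
  have : Algebra.Etale P T := inferInstance
  have : Algebra.IsUnramifiedAt P Q := inferInstance
  have : Module.Flat P T := inferInstance
  have : Module.Flat (Localization.AtPrime p) (Localization.AtPrime Q) := inferInstance
  have : Algebra.EssFiniteType (Localization.AtPrime p) (Localization.AtPrime Q) := .of_comp P _ _
  have : IsRegularLocalRing (Localization.AtPrime Q) :=
    .of_flat_of_map_maximalIdeal (A := Localization.AtPrime p) 
      Algebra.FormallyUnramified.map_maximalIdeal
  have : IsLocalization.AtPrime (Localization.AtPrime Q) q := by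
    have := IsLocalization.isLocalization_isLocalization_atPrime_isLocalization (.powers f)
      (Localization.AtPrime Q) Q
    convert this using 1
    exact hQq.symm
  exact .of_ringEquiv
    (IsLocalization.algEquiv q.primeCompl (Localization.AtPrime Q) _).toRingEquiv

end LocalAlgebra

/-! ### Smooth loci of morphisms of schemes. -/

section SmoothLocus

open IsLocalRing

namespace AlgebraicGeometry

open Limits

/-- The hypothesis `hpb` says that the fibre of `f` through the rational point `e` is `e` itself.
This yields equality of residue fields and generation of the maximal ideal; `ε` is an arbitrary ring
isomorphism. -/
theorem mem_smoothLocus_of_isPullback {k : Type u} [Field k] {X Y : Scheme.{u}} (f : X ⟶ Y)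
    [LocallyOfFinitePresentation f] [IsLocallyNoetherian X] [IsLocallyNoetherian Y]
    (e : Spec (.of k) ⟶ X) (s : Y ⟶ Spec (.of k)) (hs : (e ≫ f) ≫ s = 𝟙 _)
    (hpb : IsPullback e (𝟙 _) f (e ≫ f))
    (ε : X.presheaf.stalk (e (closedPoint k)) ≃+* Y.presheaf.stalk (f (e (closedPoint k)))) :
    e (closedPoint k) ∈ f.smoothLocus := by
  let x : X := e (closedPoint k)
  let A := Y.presheaf.stalk (f x)
  let B := X.presheaf.stalk x
  let φ : A ⟶ B := f.stalkMap x
  let ψ : B ⟶ .of k := Scheme.stalkClosedPointTo e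
  have hψ : Spec.map ψ ≫ X.fromSpecStalk x = e := Scheme.Spec_stalkClosedPointTo_fromSpecStalk e
  have hφ : Spec.map φ ≫ Y.fromSpecStalk (f x) = X.fromSpecStalk x ≫ f :=
    Scheme.SpecMap_stalkMap_fromSpecStalk f
  have hφψ : Spec.map (φ ≫ ψ) ≫ Y.fromSpecStalk (f x) = e ≫ f := by
    rw [Spec.map_comp, Category.assoc, hφ, ← Category.assoc, hψ]
  have hsurj : Function.Surjective (φ ≫ ψ).hom := by
    obtain ⟨σ, hσ⟩ := Spec.map_surjective (Y.fromSpecStalk (f x) ≫ s)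
    have : σ ≫ φ ≫ ψ = 𝟙 _ := by
      apply Spec.map_injective
      rw [Spec.map_comp, hσ, ← Category.assoc, hφψ, hs, Spec.map_id]
    intro c
    exact ⟨σ.hom c, congr($(this).hom c)⟩
  have hψm (b : B) : ψ.hom b = 0 ↔ b ∈ maximalIdeal B := by
    rw [mem_maximalIdeal, mem_nonunits_iff, ← isUnit_map_iff ψ.hom, isUnit_iff_ne_zero, not_not]
  have hφm (a : A) (ha : (φ ≫ ψ).hom a = 0) : a ∈ maximalIdeal A := by
    rw [mem_maximalIdeal, mem_nonunits_iff]
    intro h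
    exact (h.map (φ ≫ ψ).hom).ne_zero ha
  have hres (b : B) : ∃ a : A, b - φ.hom a ∈ maximalIdeal B := by
    obtain ⟨a, ha⟩ := hsurj (ψ.hom b)
    refine ⟨a, (hψm _).mp ?_⟩
    rw [map_sub, ← ha, sub_eq_zero]
    rfl
  have hmax : (maximalIdeal A).map φ.hom = maximalIdeal B := by
    refine le_antisymm (((local_hom_TFAE φ.hom).out 0 2 :
      IsLocalHom φ.hom ↔ _).mp (inferInstanceAs (IsLocalHom (f.stalkMap x).hom))) fun b hb ↦ ?_
    -- `Spec (B ⧸ I)` lies over the point `e ≫ f`, so by `hpb` its map to `X` factors through `e`.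
    -- Hence `B → B ⧸ I` factors through `ψ` and kills the maximal ideal.
    let I := (maximalIdeal A).map φ.hom
    let q : B ⟶ .of (B ⧸ I) := CommRingCat.ofHom (Ideal.Quotient.mk I)
    have hker (a : A) (ha : (φ ≫ ψ).hom a = 0) : (φ ≫ q).hom a = 0 :=
      Ideal.Quotient.eq_zero_iff_mem.mpr (Ideal.mem_map_of_mem _ (hφm a ha))
    obtain ⟨c, hc⟩ : ∃ c : CommRingCat.of k ⟶ .of (B ⧸ I), φ ≫ q = (φ ≫ ψ) ≫ c :=
      ⟨CommRingCat.ofHom ((φ ≫ ψ).hom.liftOfSurjective hsurj ⟨(φ ≫ q).hom, hker⟩), by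
        ext a
        exact (RingHom.liftOfRightInverse_comp_apply (φ ≫ ψ).hom _
          (Function.rightInverse_surjInv hsurj) ⟨(φ ≫ q).hom, hker⟩ a).symm⟩
    have ht : (Spec.map q ≫ X.fromSpecStalk x) ≫ f = Spec.map c ≫ e ≫ f := by
      rw [Category.assoc, ← hφ, ← Category.assoc, ← Spec.map_comp, hc, Spec.map_comp,
        Category.assoc, hφψ]
    have h₁ := hpb.lift_fst _ _ ht
    have h₂ := hpb.lift_snd _ _ ht
    rw [Category.comp_id] at h₂
    rw [h₂, ← hψ, ← Category.assoc, cancel_mono, ← Spec.map_comp] at h₁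
    have h₃ : ψ ≫ c = q := Spec.map_injective h₁
    have : q.hom b = 0 := by
      rw [← h₃, CommRingCat.hom_comp, RingHom.comp_apply, (hψm b).mpr hb, map_zero]
    exact Ideal.Quotient.eq_zero_iff_mem.mp this
  rw [Scheme.Hom.mem_smoothLocus]
  have hess := LocallyOfFiniteType.stalkMap f x
  have hloc : IsLocalHom φ.hom := inferInstance
  algebraize [(f.stalkMap x).hom]
  exact Algebra.FormallySmooth.of_ringEquiv_of_map_maximalIdeal (A := A) (B := B) ε hmax hres

theorem Scheme.Opens.exists_comp_ι_eq {X Y : Scheme.{u}} (U : X.Opens) (f : Y ⟶ X)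
    (hf : ∀ y, f y ∈ U) : ∃ g : Y ⟶ U, g ≫ U.ι = f := by
  have hr : Set.range f ⊆ Set.range U.ι := by
    rintro _ ⟨y, rfl⟩
    rw [Scheme.Opens.range_ι]
    exact hf y
  exact ⟨IsOpenImmersion.lift U.ι f hr, IsOpenImmersion.lift_fac _ _ _⟩

namespace Scheme.Hom

variable {X Y Z : Scheme.{u}}

theorem mem_smoothLocus_of_isPullback_of_mem {P : Scheme.{u}} {fst : P ⟶ X} {snd : P ⟶ Y}
    {f : X ⟶ Z} {g : Y ⟶ Z} (h : IsPullback fst snd f g) [LocallyOfFinitePresentation f]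
    [LocallyOfFinitePresentation snd] {p : P} (hp : fst p ∈ f.smoothLocus) :
    p ∈ snd.smoothLocus := by
  let W := f.smoothLocus
  have : Smooth (W.ι ≫ f) := by
    rw [← smoothLocus_eq_top_iff, ← preimage_smoothLocus_eq]
    exact W.ι_preimage_self
  let V := fst ⁻¹ᵁ W
  have hV : IsPullback (fst ∣_ W) V.ι W.ι fst := isPullback_morphismRestrict fst W
  have hsm : Smooth (V.ι ≫ snd) :=
    MorphismProperty.of_isPullback (hV.flip.paste_horiz h.flip).flip ‹Smooth (W.ι ≫ f)›
  have : (⟨p, hp⟩ : V) ∈ (V.ι ≫ snd).smoothLocus := by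
    rw [smoothLocus_eq_top]; trivial
  rwa [← preimage_smoothLocus_eq] at this

end Scheme.Hom

theorem isRegularLocalRing_stalk_of_mem_smoothLocus {k : Type u} [Field k] {X : Scheme.{u}}
    (f : X ⟶ Spec (.of k)) [LocallyOfFinitePresentation f] {x : X} (hx : x ∈ f.smoothLocus) :
    IsRegularLocalRing (X.presheaf.stalk x) := by
  obtain ⟨_, ⟨V, hV, rfl⟩, hxV, -⟩ :=
    X.isBasis_affineOpens.exists_subset_of_mem_open (Set.mem_univ x) isOpen_univ
  have hU : IsAffineOpen (⊤ : (Spec (.of k)).Opens) := isAffineOpen_top _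
  have hVU : V ≤ f ⁻¹ᵁ ⊤ := le_top
  have hft := f.finiteType_appLE hU hV hVU
  have : IsRegularRing Γ(Spec (.of k), ⊤) :=
    .of_ringEquiv (R := k) (Scheme.ΓSpecIso (.of k)).symm.commRingCatIsoToRingEquiv
  algebraize [(f.appLE ⊤ V hVU).hom]
  have : Algebra.IsSmoothAt Γ(Spec (.of k), ⊤) (hV.primeIdealOf ⟨x, hxV⟩).asIdeal :=
    (formallySmooth_stalkMap_iff ⊤ hU V hV hVU hxV).mp hx
  have := Algebra.IsSmoothAt.isRegularLocalRing (R := Γ(Spec (.of k), ⊤))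
    (hV.primeIdealOf ⟨x, hxV⟩).asIdeal
  have := hV.isLocalization_stalk ⟨x, hxV⟩
  let := X.presheaf.algebra_section_stalk ⟨x, hxV⟩
  exact .of_ringEquiv (IsLocalization.algEquiv (hV.primeIdealOf ⟨x, hxV⟩).asIdeal.primeCompl
    (Localization.AtPrime (hV.primeIdealOf ⟨x, hxV⟩).asIdeal) (X.presheaf.stalk x)).toRingEquiv

end AlgebraicGeometry

end SmoothLocus

/-! ### Units of a monoid object in a cartesian monoidal category. -/

namespace CategoryTheory

open MonoidalCategory CartesianMonoidalCategory CategoryTheory.MonObj Limits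

variable {C : Type*} [Category C] [CartesianMonoidalCategory C]

/-- A morphism `p : G ⟶ M` represents the units of a monoid object `M` if it is a monomorphism and
the generalized points of `M` that factor through `p` are exactly the invertible ones. -/
structure RepresentsUnits {G M : C} [MonObj M] (p : G ⟶ M) : Prop where
  mono : Mono p
  isUnit_iff : ∀ {T : C} (x : T ⟶ M), IsUnit x ↔ ∃ y : T ⟶ G, y ≫ p = x

namespace RepresentsUnits

variable {G M : C} [MonObj M] {p : G ⟶ M} (hp : RepresentsUnits p)

include hp

theorem isUnit_comp {T : C} (y : T ⟶ G) : IsUnit (y ≫ p) :=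
  (hp.isUnit_iff _).mpr ⟨y, rfl⟩

theorem of_iso {G' : C} {p' : G' ⟶ M} (e : G ≅ G') (he : e.hom ≫ p' = p) :
    RepresentsUnits p' := by
  have := hp.mono
  have he' : p' = e.inv ≫ p := by rw [← he, Iso.inv_hom_id_assoc]
  refine ⟨he' ▸ inferInstance, fun {T} x ↦ (hp.isUnit_iff x).trans ⟨?_, ?_⟩⟩
  · rintro ⟨y, rfl⟩
    exact ⟨y ≫ e.hom, by rw [Category.assoc, he]⟩
  · rintro ⟨y, rfl⟩
    exact ⟨y ≫ e.inv, by rw [Category.assoc, he']⟩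

/-- The factorization of an invertible generalized point. -/
noncomputable def lift {T : C} (x : T ⟶ M) (hx : IsUnit x) : T ⟶ G :=
  ((hp.isUnit_iff x).mp hx).choose

theorem lift_comp {T : C} (x : T ⟶ M) (hx : IsUnit x) : hp.lift x hx ≫ p = x :=
  ((hp.isUnit_iff x).mp hx).choose_spec

/-- The monoid structure on an object representing the units. -/
@[reducible]
noncomputable def monObj : MonObj G where
  one := hp.lift 1 isUnit_one
  mul := hp.lift ((fst G G ≫ p) * (snd G G ≫ p)) ((hp.isUnit_comp _).mul (hp.isUnit_comp _))
  one_mul := by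
    have := hp.mono
    rw [← cancel_mono p, Category.assoc, hp.lift_comp, comp_mul, ← Category.assoc,
      ← Category.assoc, whiskerRight_fst, whiskerRight_snd, Category.assoc, hp.lift_comp, comp_one,
      _root_.one_mul, leftUnitor_hom]
  mul_one := by
    have := hp.mono
    rw [← cancel_mono p, Category.assoc, hp.lift_comp, comp_mul, ← Category.assoc,
      ← Category.assoc, whiskerLeft_fst, whiskerLeft_snd, Category.assoc, hp.lift_comp, comp_one,
      _root_.mul_one, rightUnitor_hom]
  mul_assoc := by
    have := hp.mono
    rw [← cancel_mono p]
    simp only [Category.assoc, hp.lift_comp, comp_mul, whiskerRight_fst_assoc,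
      whiskerRight_snd_assoc, whiskerLeft_fst_assoc, whiskerLeft_snd_assoc, associator_hom_fst_assoc,
      associator_hom_snd_fst_assoc, associator_hom_snd_snd_assoc, _root_.mul_assoc]

theorem isMonHom : letI := hp.monObj; IsMonHom p := by
  let := hp.monObj
  refine ⟨?_, ?_⟩
  · refine (hp.lift_comp _ _).trans ?_
    rw [Hom.one_def, toUnit_unique (toUnit (𝟙_ C)) (𝟙 _), Category.id_comp]
  · refine (hp.lift_comp _ _).trans ?_
    rw [Hom.mul_def]
    congr 1
    ext <;> simp

/-- The group structure on an object representing the units. -/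
@[reducible]
noncomputable def grpObj : GrpObj G :=
  letI := hp.monObj
  haveI := hp.isMonHom
  haveI := hp.mono
  GrpObj.ofInvertible G fun _ f ↦
    { invOf := hp.lift _ (hp.isUnit_comp f).unit⁻¹.isUnit
      invOf_mul_self := by
        rw [← cancel_mono p, mul_comp, one_comp, hp.lift_comp, IsUnit.val_inv_mul]
      mul_invOf_self := by
        rw [← cancel_mono p, mul_comp, one_comp, hp.lift_comp, IsUnit.mul_val_inv] }

theorem exists_grpObj : ∃ _ : GrpObj G, IsMonHom p :=
  ⟨hp.grpObj, hp.isMonHom⟩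

end RepresentsUnits

namespace MonObj

variable {M : C} [MonObj M]

/-- Left translation by a global point of a monoid object. -/
def leftTranslate (u : 𝟙_ C ⟶ M) : M ⟶ M := (toUnit M ≫ u) * 𝟙 M

theorem comp_leftTranslate {T : C} (x : T ⟶ M) (u : 𝟙_ C ⟶ M) :
    x ≫ leftTranslate u = (toUnit T ≫ u) * x := by
  rw [leftTranslate, comp_mul, ← Category.assoc, toUnit_unique (x ≫ toUnit M) (toUnit T),
    Category.comp_id]

theorem point_comp_leftTranslate (x u : 𝟙_ C ⟶ M) : x ≫ leftTranslate u = u * x := by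
  rw [comp_leftTranslate, toUnit_unique (toUnit (𝟙_ C)) (𝟙 _), Category.id_comp]

theorem leftTranslate_comp_leftTranslate (u v : 𝟙_ C ⟶ M) :
    leftTranslate u ≫ leftTranslate v = leftTranslate (v * u) := by
  rw [comp_leftTranslate, leftTranslate, leftTranslate, comp_mul, _root_.mul_assoc]

theorem leftTranslate_one : leftTranslate (1 : 𝟙_ C ⟶ M) = 𝟙 M := by
  rw [leftTranslate, comp_one, _root_.one_mul]

/-- Left translation by an invertible global point of a monoid object. -/
@[simps]
def leftTranslateIso (u : (𝟙_ C ⟶ M)ˣ) : M ≅ M where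
  hom := leftTranslate u
  inv := leftTranslate ↑u⁻¹
  hom_inv_id := by rw [leftTranslate_comp_leftTranslate, Units.inv_mul, leftTranslate_one]
  inv_hom_id := by rw [leftTranslate_comp_leftTranslate, Units.mul_inv, leftTranslate_one]

end MonObj

/-- Multiplication by `u` both preserves and reflects invertibility. The cartesian square transports
smoothness of `p` from one point of `G` to another. -/
theorem RepresentsUnits.exists_isPullback_leftTranslate {G M : C} [MonObj M] {p : G ⟶ M}
    (hp : RepresentsUnits p) (u : (𝟙_ C ⟶ M)ˣ) :
    ∃ α : G ⟶ G, IsPullback α p p (leftTranslate (u : 𝟙_ C ⟶ M)) := by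
  have := hp.mono
  have hu (v : (𝟙_ C ⟶ M)ˣ) {T : C} (y : T ⟶ M) (hy : IsUnit y) :
      IsUnit (y ≫ leftTranslate (v : 𝟙_ C ⟶ M)) := by
    rw [comp_leftTranslate]
    refine IsUnit.mul ⟨⟨toUnit T ≫ v, toUnit T ≫ ↑v⁻¹, ?_, ?_⟩, rfl⟩ hy
    · rw [← comp_mul, Units.mul_inv, comp_one]
    · rw [← comp_mul, Units.inv_mul, comp_one]
  let α : G ⟶ G := hp.lift (p ≫ leftTranslate ↑u)
    (hu u p ((hp.isUnit_iff p).mpr ⟨𝟙 G, Category.id_comp p⟩))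
  have hα : α ≫ p = p ≫ leftTranslate ↑u := hp.lift_comp _ _
  have hs (s : PullbackCone p (leftTranslate (u : 𝟙_ C ⟶ M))) : IsUnit s.snd := by
    have h := hu u⁻¹ _ (hp.isUnit_comp s.fst)
    rwa [s.condition, Category.assoc, leftTranslate_comp_leftTranslate, Units.inv_mul, leftTranslate_one,
      Category.comp_id] at h
  refine ⟨α, ⟨hα⟩, ⟨PullbackCone.IsLimit.mk _ (fun s ↦ hp.lift s.snd (hs s)) (fun s ↦ ?_)
    (fun s ↦ hp.lift_comp _ _) fun s m _ h ↦ ?_⟩⟩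
  · rw [← cancel_mono p, Category.assoc, hα, ← Category.assoc, hp.lift_comp, s.condition]
  · rw [← cancel_mono p, hp.lift_comp, h]

theorem CartesianMonoidalCategory.exists_eq_lift_lift {M T : C} (f : T ⟶ M ⊗ (M ⊗ M)) : ∃ x y z : T ⟶ M,
    f = CartesianMonoidalCategory.lift x (CartesianMonoidalCategory.lift y z) :=
  ⟨f ≫ fst _ _, f ≫ snd _ _ ≫ fst _ _, f ≫ snd _ _ ≫ snd _ _, by ext <;> simp⟩

theorem CartesianMonoidalCategory.lift_lift_inj {M T : C} {x y z x' y' z' : T ⟶ M} :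
    CartesianMonoidalCategory.lift x (CartesianMonoidalCategory.lift y z) =
      CartesianMonoidalCategory.lift x' (CartesianMonoidalCategory.lift y' z') ↔
      x = x' ∧ y = y' ∧ z = z' := by
  refine ⟨fun h ↦ ⟨?_, ?_, ?_⟩, by rintro ⟨rfl, rfl, rfl⟩; rfl⟩
  · simpa using congr($h ≫ fst _ _)
  · simpa using congr($h ≫ snd _ _ ≫ fst _ _)
  · simpa using congr($h ≫ snd _ _ ≫ snd _ _)

namespace MonObj

variable (M : C) [MonObj M]

/-- The morphism `(x, y, z) ↦ (x, xy, zx)`. -/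
def shear : M ⊗ (M ⊗ M) ⟶ M ⊗ (M ⊗ M) :=
  CartesianMonoidalCategory.lift (fst _ _)
    (CartesianMonoidalCategory.lift (fst _ _ * (snd _ _ ≫ fst _ _)) ((snd _ _ ≫ snd _ _) * fst _ _))

variable {M}

theorem lift_comp_shear {T : C} (x y z : T ⟶ M) :
    CartesianMonoidalCategory.lift x (CartesianMonoidalCategory.lift y z) ≫ shear M =
      CartesianMonoidalCategory.lift x (CartesianMonoidalCategory.lift (x * y) (z * x)) := by
  ext <;> simp [shear, comp_mul]

variable (M) in
/-- The neutral point of `M ⊗ (M ⊗ M)`. -/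
def oneTriple : 𝟙_ C ⟶ M ⊗ (M ⊗ M) :=
  CartesianMonoidalCategory.lift 1 (CartesianMonoidalCategory.lift 1 1)

variable (M) in
theorem oneTriple_comp_shear : oneTriple M ≫ shear M = oneTriple M := by
  rw [oneTriple, lift_comp_shear, _root_.one_mul]

/-- From `(x, xy, zx) = (1, 1, 1)` one reads `x = 1`, then `y = z = 1`; no inverses are needed. -/
theorem eq_comp_oneTriple {T : C} {f : T ⟶ M ⊗ (M ⊗ M)} {g : T ⟶ 𝟙_ C}
    (h : f ≫ shear M = g ≫ oneTriple M) : f = g ≫ oneTriple M := by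
  obtain ⟨x, y, z, rfl⟩ := exists_eq_lift_lift f
  rw [lift_comp_shear, oneTriple, comp_lift, comp_lift, lift_lift_inj, comp_one] at h
  obtain ⟨rfl, hy, hz⟩ := h
  rw [_root_.one_mul] at hy
  rw [_root_.mul_one] at hz
  rw [hy, hz, oneTriple, comp_lift, comp_lift, comp_one]

variable (M) in
theorem isPullback_oneTriple_shear :
    IsPullback (oneTriple M) (𝟙 _) (shear M) (oneTriple M ≫ shear M) := by
  have h (s : PullbackCone (shear M) (oneTriple M ≫ shear M)) : s.fst = s.snd ≫ oneTriple M :=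
    eq_comp_oneTriple (s.condition.trans (s.snd ≫= oneTriple_comp_shear M))
  exact ⟨⟨by rw [Category.id_comp]⟩, ⟨PullbackCone.IsLimit.mk _ (fun s ↦ s.snd)
    (fun s ↦ (h s).symm) (fun s ↦ Category.comp_id _) fun s m _ _ ↦ toUnit_unique _ _⟩⟩

end MonObj

/-- A right inverse `y` and a left inverse `z` of `x` coincide and are unique. Keeping both
coordinates is what makes `p` a monomorphism when `M` is not commutative. -/
theorem RepresentsUnits.of_isPullback_shear {G M : C} [MonObj M] {p : G ⟶ M}
    {q : G ⟶ M ⊗ (M ⊗ M)}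
    (h : IsPullback q p (shear M)
      (CartesianMonoidalCategory.lift (𝟙 M) (CartesianMonoidalCategory.lift 1 1))) :
    RepresentsUnits p := by
  have key {T : C} (v : T ⟶ G) : ∃ y z : T ⟶ M, (v ≫ p) * y = 1 ∧ z * (v ≫ p) = 1 ∧
      v ≫ q = CartesianMonoidalCategory.lift (v ≫ p) (CartesianMonoidalCategory.lift y z) := by
    obtain ⟨x, y, z, hv⟩ := exists_eq_lift_lift (v ≫ q)
    have hw := v ≫= h.w
    rw [← Category.assoc, hv, lift_comp_shear, ← Category.assoc, comp_lift, comp_lift,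
      lift_lift_inj, comp_one, Category.comp_id] at hw
    obtain ⟨rfl, hy, hz⟩ := hw
    exact ⟨y, z, hy, hz, hv⟩
  refine ⟨⟨fun {T} v w hvw ↦ h.hom_ext ?_ hvw⟩, fun {T} x ↦ ⟨?_, ?_⟩⟩
  · obtain ⟨y, z, hy, hz, hv⟩ := key v
    obtain ⟨y', z', hy', hz', hw⟩ := key w
    rw [hv, hw, lift_lift_inj]
    rw [hvw] at hy hz
    exact ⟨hvw, (left_inv_eq_right_inv hz' hy).symm.trans (left_inv_eq_right_inv hz' hy'),
      (left_inv_eq_right_inv hz hy').trans (left_inv_eq_right_inv hz' hy').symm⟩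
  · rintro ⟨u, rfl⟩
    have hw : CartesianMonoidalCategory.lift (u : T ⟶ M)
        (CartesianMonoidalCategory.lift (↑u⁻¹ : T ⟶ M) ↑u⁻¹) ≫ shear M =
        (u : T ⟶ M) ≫ CartesianMonoidalCategory.lift (𝟙 M)
          (CartesianMonoidalCategory.lift 1 1) := by
      rw [lift_comp_shear, comp_lift, comp_lift, comp_one, Category.comp_id, Units.mul_inv,
        Units.inv_mul]
    exact ⟨h.lift _ _ hw, h.lift_snd _ _ hw⟩
  · rintro ⟨v, rfl⟩
    obtain ⟨y, z, hy, hz, -⟩ := key v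
    exact ⟨⟨v ≫ p, y, hy, by rwa [← left_inv_eq_right_inv hz hy]⟩, rfl⟩

theorem MonObj.exists_representsUnits [HasPullbacks C] (M : C) [MonObj M] :
    ∃ (G : C) (q : G ⟶ M ⊗ (M ⊗ M)) (p : G ⟶ M), RepresentsUnits p ∧
      IsPullback q p (shear M)
        (CartesianMonoidalCategory.lift (𝟙 M) (CartesianMonoidalCategory.lift 1 1)) :=
  ⟨_, _, _, .of_isPullback_shear (.of_hasPullback _ _), .of_hasPullback _ _⟩

end CategoryTheory

/-! ### Algebraic monoids over a field. -/

namespace AlgMon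

open MonoidalCategory CartesianMonoidalCategory CategoryTheory.MonObj Limits
open IsLocalRing (closedPoint)

variable {k : Type u} [Field k]

local instance (M N : Over (Spec (.of k))) [LocallyOfFiniteType M.hom]
    [LocallyOfFiniteType N.hom] : LocallyOfFiniteType (M ⊗ N).hom := by
  rw [← Over.w (fst M N)]
  have : LocallyOfFiniteType (fst M N).left :=
    inferInstanceAs (LocallyOfFiniteType (pullback.fst M.hom N.hom))
  infer_instance

local instance (X : Over (Spec (.of k))) [LocallyOfFiniteType X.hom] :
    IsLocallyNoetherian X.left :=
  LocallyOfFiniteType.isLocallyNoetherian X.hom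

local instance {X Y : Over (Spec (.of k))} (f : X ⟶ Y) [h : LocallyOfFiniteType X.hom] :
    LocallyOfFiniteType f.left := by
  rw [← Over.w f] at h
  exact locallyOfFiniteType_of_comp f.left Y.hom

theorem toPoint_comp {X Y : Over (Spec (.of k))} (x : 𝟙_ (Over (Spec (.of k))) ⟶ X) (f : X ⟶ Y) :
    toPoint (x ≫ f) = f.left (toPoint x) :=
  rfl

theorem exists_toPoint_eq [IsAlgClosed k] {X : Over (Spec (.of k))} [LocallyOfFiniteType X.hom]
    {p : X.left} (hp : p ∈ closedPoints X.left) :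
    ∃ x : 𝟙_ (Over (Spec (.of k))) ⟶ X, toPoint x = p :=
  ⟨Over.homMk (pointOfClosedPoint X.hom p hp) (pointOfClosedPoint_comp X.hom p hp),
    pointOfClosedPoint_apply X.hom p hp _⟩

theorem toPoint_mem_closedPoints [IsAlgClosed k] {X : Over (Spec (.of k))}
    [LocallyOfFiniteType X.hom] (x : 𝟙_ (Over (Spec (.of k))) ⟶ X) :
    toPoint x ∈ closedPoints X.left :=
  (pointEquivClosedPoint X.hom ⟨x.left, Over.w x⟩).2

theorem toPoint_oneTriple_mem_smoothLocus (M : Over (Spec (.of k))) [LocallyOfFiniteType M.hom]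
    [MonObj M] : toPoint (oneTriple M) ∈ (shear M).left.smoothLocus := by
  have h := (isPullback_oneTriple_shear M).map (Over.forget (Spec (.of k)))
  have hpt : (shear M).left (toPoint (oneTriple M)) = toPoint (oneTriple M) := by
    rw [← toPoint_comp, oneTriple_comp_shear]
  refine mem_smoothLocus_of_isPullback (shear M).left (oneTriple M).left
    (M ⊗ (M ⊗ M)).hom (Over.w (oneTriple M ≫ shear M)) ?_ ?_
  · convert! h
  -- The shear fixes the neutral triple, so its source and target stalks there are stalks of one
  -- scheme at one point.
  · exact ((M ⊗ (M ⊗ M)).left.presheaf.stalkCongr (.of_eq hpt.symm)).commRingCatIsoToRingEquiv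

theorem isOpenImmersion_of_isPullback_shear [IsAlgClosed k] {G M : Over (Spec (.of k))}
    [LocallyOfFiniteType M.hom] [MonObj M] {p : G ⟶ M} {q : G ⟶ M ⊗ (M ⊗ M)}
    (hp : RepresentsUnits p)
    (h : IsPullback q p (shear M)
      (CartesianMonoidalCategory.lift (𝟙 M) (CartesianMonoidalCategory.lift 1 1))) :
    IsOpenImmersion p.left := by
  have := hp.mono
  have hsq : IsPullback q.left p.left (shear M).left _ := h.map (Over.forget (Spec (.of k)))
  have : LocallyOfFiniteType p.left :=
    MorphismProperty.of_isPullback hsq (inferInstanceAs (LocallyOfFiniteType (shear M).left))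
  have : LocallyOfFiniteType G.hom := by
    rw [← Over.w p]
    infer_instance
  have : JacobsonSpace G.left := LocallyOfFiniteType.jacobsonSpace G.hom
  let e : 𝟙_ (Over (Spec (.of k))) ⟶ G := hp.lift 1 isUnit_one
  have he : e ≫ p = 1 := hp.lift_comp _ _
  have heq : e ≫ q = oneTriple M := by
    rw [← Category.id_comp (oneTriple M)]
    apply eq_comp_oneTriple
    rw [Category.assoc, h.w, ← Category.assoc, he, comp_lift, comp_lift, comp_one,
      Category.comp_id, Category.id_comp, oneTriple]
  have hsm : toPoint e ∈ p.left.smoothLocus := by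
    refine Scheme.Hom.mem_smoothLocus_of_isPullback_of_mem hsq ?_
    rw [← toPoint_comp, heq]
    exact toPoint_oneTriple_mem_smoothLocus M
  have hall (g : 𝟙_ (Over (Spec (.of k))) ⟶ G) : toPoint g ∈ p.left.smoothLocus := by
    -- Translation by the inverse of `g` moves `g` to the identity `e`, where smoothness is known.
    let u := (hp.isUnit_comp g).unit⁻¹
    obtain ⟨α, hα⟩ := hp.exists_isPullback_leftTranslate u
    have hg : g ≫ α = e := by
      rw [← cancel_mono p, Category.assoc, hα.w, ← Category.assoc, point_comp_leftTranslate, he]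
      exact IsUnit.val_inv_mul _
    have hα' : IsPullback α.left p.left p.left _ := hα.map (Over.forget (Spec (.of k)))
    refine Scheme.Hom.mem_smoothLocus_of_isPullback_of_mem hα' ?_
    rwa [← toPoint_comp, hg]
  have hsmooth : Smooth p.left := by
    -- A nonempty closed complement of the smooth locus would contain a closed point, which is
    -- rational over the algebraically closed `k`.
    rw [← Scheme.Hom.smoothLocus_eq_top_iff, ← TopologicalSpace.Opens.coe_eq_univ,
      ← not_ne_iff, ← Set.nonempty_compl]
    intro H
    obtain ⟨x, hx, hxc⟩ :=
      nonempty_inter_closedPoints H p.left.smoothLocus.2.isClosed_compl.isLocallyClosed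
    obtain ⟨g, rfl⟩ := exists_toPoint_eq hxc
    exact hx (hall g)
  exact IsOpenImmersion.of_flat_of_mono p.left

theorem representsUnits_openSubι {G M : Over (Spec (.of k))} [MonObj M] {p : G ⟶ M}
    (hp : RepresentsUnits p) [IsOpenImmersion p.left] :
    RepresentsUnits (openSubι M p.left.opensRange) := by
  have h : p.left.isoOpensRange.hom ≫ p.left.opensRange.ι = p.left :=
    p.left.isoOpensRange_hom_ι
  refine hp.of_iso (Over.isoMk (f := G) (g := openSub M p.left.opensRange) p.left.isoOpensRange ?_) ?_
  · exact ((Category.assoc _ _ _).symm.trans (congr($h ≫ M.hom))).trans (Over.w p)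
  · ext1
    exact h

theorem exists_opens_representsUnits [IsAlgClosed k] (M : Over (Spec (.of k)))
    [LocallyOfFiniteType M.hom] [MonObj M] :
    ∃ U : M.left.Opens, RepresentsUnits (openSubι M U) := by
  obtain ⟨G, q, p, hp, h⟩ := exists_representsUnits M
  have := isOpenImmersion_of_isPullback_shear hp h
  exact ⟨_, representsUnits_openSubι hp⟩

theorem toPoint_mem_iff_isUnit {M : Over (Spec (.of k))} [MonObj M] {U : M.left.Opens}
    (hU : RepresentsUnits (openSubι M U)) (x : 𝟙_ (Over (Spec (.of k))) ⟶ M) :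
    toPoint x ∈ U ↔ IsUnit x := by
  refine ⟨fun h ↦ ?_, fun h ↦ ?_⟩
  · rw [hU.isUnit_iff]
    obtain ⟨l, hl⟩ := U.exists_comp_ι_eq x.left fun y ↦ by
      have : y = (closedPoint k : Spec (.of k)) := Subsingleton.elim (α := Spec (.of k)) _ _
      rw [this]
      exact h
    refine ⟨Over.homMk (V := openSub M U) l ?_, ?_⟩
    · exact ((Category.assoc _ _ _).symm.trans (congr($hl ≫ M.hom))).trans (Over.w x)
    · ext1
      exact hl
  · rw [← hU.lift_comp x h, toPoint_comp]
    exact Subtype.property (p := (· ∈ U)) (toPoint (hU.lift x h))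

theorem isVariety_openSub (M : Over (Spec (.of k))) [IsVariety M] (U : M.left.Opens) :
    IsVariety (openSub M U) := by
  have := IsVariety.reduced (X := M)
  have := IsVariety.separated (X := M)
  have := IsVariety.locallyOfFiniteType (X := M)
  have := IsVariety.quasiCompact (X := M)
  exact ⟨inferInstanceAs (IsReduced U.toScheme), inferInstanceAs (IsSeparated (U.ι ≫ M.hom)),
    inferInstanceAs (LocallyOfFiniteType (U.ι ≫ M.hom)),
    inferInstanceAs (QuasiCompact (U.ι ≫ M.hom))⟩

/-- Reducedness over a perfect field makes the smooth locus dense, so it contains some unit `y`; the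
automorphism given by left translation by `y x⁻¹` carries `x` to `y`. -/
theorem isNonsingularAt_of_isUnit [IsAlgClosed k] {M : Over (Spec (.of k))} [IsReduced M.left]
    [LocallyOfFiniteType M.hom] [MonObj M] {U : M.left.Opens}
    (hU : RepresentsUnits (openSubι M U)) (x : 𝟙_ (Over (Spec (.of k))) ⟶ M) (hx : IsUnit x) :
    IsNonsingularAt M.left (toPoint x) := by
  have : JacobsonSpace M.left := LocallyOfFiniteType.jacobsonSpace M.hom
  let W := M.hom.smoothLocus
  have hne : ((U : Set M.left) ∩ W).Nonempty :=
    M.hom.dense_smoothLocus_of_perfectField.inter_open_nonempty _ U.2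
      ⟨_, (toPoint_mem_iff_isUnit hU x).mpr hx⟩
  obtain ⟨_, ⟨hyU, hyW⟩, hy⟩ := nonempty_inter_closedPoints hne (U.2.inter W.2).isLocallyClosed
  obtain ⟨y, rfl⟩ := exists_toPoint_eq hy
  let u := ((toPoint_mem_iff_isUnit hU y).mp hyU).unit * hx.unit⁻¹
  have hxy : x ≫ (leftTranslateIso u).hom = y := by
    rw [leftTranslateIso_hom, point_comp_leftTranslate]
    simp [u, _root_.mul_assoc]
  apply isRegularLocalRing_stalk_of_mem_smoothLocus M.hom
  have hmem : toPoint x ∈ (leftTranslateIso u).hom.left ⁻¹ᵁ W := by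
    rwa [← hxy] at hyW
  have : IsOpenImmersion (leftTranslateIso u).hom.left :=
    inferInstanceAs (IsOpenImmersion ((Over.forget _).mapIso (leftTranslateIso u)).hom)
  rw [Scheme.Hom.preimage_smoothLocus_eq] at hmem
  simpa only [Over.w] using hmem

end AlgMon

theorem theorem2p8 {k : Type u} [Field k] [IsAlgClosed k]
    (M : Over (Spec (.of k))) [AlgMon.IsVariety M] [MonObj M] :
    (∃ U : M.left.Opens,
      -- the closed points of the open subscheme `U` are exactly the elements of `G(M)`
      (U : Set M.left) ∩ closedPoints M.left = AlgMon.unitGroup M ∧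
      -- `U` is an algebraic group under the multiplication of `M`
      AlgMon.IsVariety (AlgMon.openSub M U) ∧
      ∃ _ : GrpObj (AlgMon.openSub M U), IsMonHom (AlgMon.openSubι M U)) ∧
    ∀ p ∈ AlgMon.unitGroup M, AlgMon.IsNonsingularAt M.left p := by
  have := AlgMon.IsVariety.reduced (X := M)
  have := AlgMon.IsVariety.locallyOfFiniteType (X := M)
  obtain ⟨U, hU⟩ := AlgMon.exists_opens_representsUnits M
  refine ⟨⟨U, ?_, AlgMon.isVariety_openSub M U, hU.exists_grpObj⟩, ?_⟩
  · ext p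
    constructor
    · rintro ⟨hpU, hp⟩
      obtain ⟨x, rfl⟩ := AlgMon.exists_toPoint_eq hp
      exact ⟨x, (AlgMon.toPoint_mem_iff_isUnit hU x).mp hpU, rfl⟩
    · rintro ⟨x, hx, rfl⟩
      exact ⟨(AlgMon.toPoint_mem_iff_isUnit hU x).mpr hx, AlgMon.toPoint_mem_closedPoints x⟩
  · rintro _ ⟨x, hx, rfl⟩
    exact AlgMon.isNonsingularAt_of_isUnit hU x hx
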